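/- Let $G$ be a finite group with irreducible complex characters $\chi_0,\chi_1,\dots,\chi_\ell$, where $\chi_0$ is the trivial character, and let $\gamma$ be a faithful $n$-dimensional complex representation of $G$ (not necessarily irreducible) with character $\chi_\gamma$. Let $M=(m_{ij})\in\mathbb{Z}^{(\ell+1)\times(\ell+1)}$ be the integer matrix defined by $\chi_\gamma\cdot\chi_i=\sum_{j=0}^{\ell}m_{ij}\chi_j$ for $0\le i\le \ell$, and let $C$ be the $\ell\times\ell$ matrix obtained from $nI-M$ by removing the row and the column corresponding to $\chi_0$. The critical group of $\gamma$ is the abelian group $K(\gamma):=\operatorname{coker}(C^t\colon\mathbb{Z}^\ell\to\mathbb{Z}^\ell)$. Let $e=c_0,c_1,\dots,c_\ell$ be a set of representatives of the conjugacy classes of $G$. Then: (i) $K(\gamma)$ is finite, and $$\frac{1}{|G|}\prod_{i=1}^{\ell}\bigl(n-\chi_\gamma(c_i)\bigr)=|K(\gamma)|.$$ (ii) If $\chi_\gamma$ is real-valued and $\chi_\gamma(c)$, for some $c\in G$, is an integer and is attained by $\chi_\gamma$ on exactly $m$ different conjugacy classes, then $K(\gamma)$ contains a subgroup isomorphic to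 $(\mathbb{Z}/(n-\chi_\gamma(c))\mathbb{Z})^{m-1}$. -/

import Mathlib

/-!
Irreducible complex characters of a finite group, the (extended) McKay-Cartan matrix of a
complex representation, and its critical group.
-/

noncomputable section

namespace CriticalGroup

open Representation

/-- `χ : G → ℂ` is an irreducible complex character of `G`: the character of an irreducible
finite-dimensional complex representation (on some `ℂ ^ d`). -/
def IsIrrChar {G : Type*} [Group G] (χ : G → ℂ) : Prop :=
  ∃ (d : ℕ) (ρ : Representation ℂ G (Fin d → ℂ)), ρ.IsIrreducible ∧ ρ.character = χ

/-- The set of irreducible complex characters `χ_0, …, χ_ℓ` of `G`, as a type. -/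
@[ext]
structure Irr (G : Type*) [Group G] where
  /-- The character as a function on the group. -/
  val : G → ℂ
  isIrrChar : IsIrrChar val

/-- Transport of a representation along a linear equivalence. -/
def transport {G V W : Type*} [Group G] [AddCommGroup V] [Module ℂ V] [AddCommGroup W]
    [Module ℂ W] (ρ : Representation ℂ G V) (e : V ≃ₗ[ℂ] W) : Representation ℂ G W where
  toFun g := e.conj (ρ g)
  map_one' := by rw [map_one]; exact e.conj_id
  map_mul' g h := by rw [map_mul]; exact e.conj_comp (ρ h) (ρ g)

theorem transport_character {G V W : Type*} [Group G] [AddCommGroup V] [Module ℂ V]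
    [AddCommGroup W] [Module ℂ W] (ρ : Representation ℂ G V) (e : V ≃ₗ[ℂ] W) :
    (transport ρ e).character = ρ.character := by
  ext g
  exact LinearMap.trace_conj' (ρ g) e

theorem transport_irreducible {G V W : Type*} [Group G] [AddCommGroup V] [Module ℂ V]
    [AddCommGroup W] [Module ℂ W] (ρ : Representation ℂ G V) (e : V ≃ₗ[ℂ] W)
    (h : ρ.IsIrreducible) : (transport ρ e).IsIrreducible := by
  let i : Subrepresentation ρ ≃o Subrepresentation (transport ρ e) :=
    { toFun := fun S => ⟨S.toSubmodule.map e.toLinearMap, by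
        rintro g _ ⟨v, hv, rfl⟩
        exact ⟨ρ g v, S.apply_mem_toSubmodule g hv, by simp [transport, LinearEquiv.conj_apply]⟩⟩
      invFun := fun S => ⟨S.toSubmodule.comap e.toLinearMap, by
        intro g v hv
        have := S.apply_mem_toSubmodule g hv
        simpa [transport, LinearEquiv.conj_apply] using this⟩
      left_inv := fun S => Subrepresentation.toSubmodule_injective
        (Submodule.comap_map_eq_of_injective e.injective _)
      right_inv := fun S => Subrepresentation.toSubmodule_injective
        (Submodule.map_comap_eq_of_surjective e.surjective _)
      map_rel_iff' := fun {S T} => Submodule.map_le_map_iff_of_injective e.injective _ _ }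
  exact (OrderIso.isSimpleOrder_iff i).mp h

/-- The character of an irreducible finite-dimensional representation on any space is an
irreducible character. -/
theorem isIrrChar_character {G V : Type*} [Group G] [AddCommGroup V] [Module ℂ V]
    [FiniteDimensional ℂ V] (ρ : Representation ℂ G V) (h : ρ.IsIrreducible) :
    IsIrrChar ρ.character :=
  ⟨_, transport ρ (Module.finBasis ℂ V).equivFun, transport_irreducible ρ _ h,
    transport_character ρ _⟩

/-- The trivial character is irreducible. -/
theorem isIrrChar_one {G : Type*} [Group G] : IsIrrChar (1 : G → ℂ) := by
  have h : (Representation.trivial ℂ G ℂ).IsIrreducible := by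
    have : Nontrivial (Subrepresentation (Representation.trivial ℂ G ℂ)) :=
      ⟨⊥, ⊤, fun h => bot_ne_top (congrArg Subrepresentation.toSubmodule h)⟩
    refine ⟨fun S => ?_⟩
    rcases eq_bot_or_eq_top S.toSubmodule with h | h
    · exact Or.inl (Subrepresentation.toSubmodule_injective h)
    · exact Or.inr (Subrepresentation.toSubmodule_injective h)
  convert isIrrChar_character _ h using 1
  ext g
  simp [Representation.character, Representation.trivial]

/-- The trivial character `χ_0`. -/
def trivialChar (G : Type*) [Group G] : Irr G := ⟨1, isIrrChar_one⟩

/-- The irreducible characters of a finite group are linearly independent. -/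
theorem linearIndependent_irr (G : Type*) [Group G] [Finite G] :
    LinearIndependent ℂ (fun χ : Irr G => χ.1) := by
  classical
  have := Fintype.ofFinite G
  have hG : (Nat.card G : ℂ) ≠ 0 := by simp
  have : Invertible (Nat.card G : ℂ) := invertibleOfNonzero hG
  have key : ∀ χ ψ : Irr G, (Nat.card G : ℂ)⁻¹ * ∑ g : G, χ.1 g * ψ.1 g⁻¹ =
      if χ = ψ then 1 else 0 := by
    rintro ⟨_, d, ρ, hρ, rfl⟩ ⟨_, d', σ, hσ, rfl⟩
    rw [Representation.char_orthonormal ρ σ]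
    have hiff : Nonempty (Representation.Equiv σ ρ) ↔ ρ.character = σ.character := by
      constructor
      · rintro ⟨φ⟩
        exact (char_iso φ).symm
      · intro h
        by_contra hne
        have h1 := Representation.char_orthonormal ρ σ
        have h2 := Representation.char_orthonormal ρ ρ
        rw [if_neg hne, ← h] at h1
        rw [if_pos ⟨Representation.Equiv.refl ρ⟩, h1] at h2
        exact zero_ne_one h2
    exact if_congr (hiff.trans ⟨fun h => Irr.ext h, fun h => congrArg Irr.val h⟩) rfl rfl
  rw [linearIndependent_iff']
  intro s f hf ψ hψ
  have h : (Nat.card G : ℂ)⁻¹ * ∑ g : G, (∑ χ ∈ s, f χ • χ.1) g * ψ.1 g⁻¹ = f ψ := by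
    have : ∀ g, (∑ χ ∈ s, f χ • χ.1) g * ψ.1 g⁻¹ = ∑ χ ∈ s, f χ * (χ.1 g * ψ.1 g⁻¹) := by
      intro g
      simp [Finset.sum_apply, Finset.sum_mul, mul_assoc]
    simp_rw [this]
    rw [Finset.sum_comm, Finset.mul_sum]
    simp only [← Finset.mul_sum, mul_left_comm _ (f _), key]
    simp [hψ]
  rw [← h, hf]
  simp

instance (G : Type*) [Group G] [Finite G] : Finite (Irr G) :=
  (linearIndependent_irr G).finite

instance (G : Type*) [Group G] [Finite G] : Fintype (Irr G) := Fintype.ofFinite _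

instance (G : Type*) [Group G] : DecidableEq (Irr G) := Classical.decEq _

/-- Every finite-dimensional complex character is a nonnegative integral combination of
irreducible characters. -/
theorem exists_multiplicities {G : Type*} [Group G] [Finite G] (n : ℕ) :
    ∀ {V : Type*} [AddCommGroup V] [Module ℂ V] [FiniteDimensional ℂ V]
      (ρ : Representation ℂ G V), Module.finrank ℂ V = n →
      ∃ m : Irr G → ℕ, ρ.character = ∑ χ : Irr G, (m χ : ℂ) • χ.1 := by
  induction n using Nat.strong_induction_on with
  | _ n ih =>
  intro V _ _ _ ρ hn
  have hG : NeZero (Nat.card G : ℂ) := ⟨Nat.cast_ne_zero.mpr Nat.card_pos.ne'⟩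
  by_cases hirr : ρ.IsIrreducible
  · refine ⟨Pi.single ⟨_, isIrrChar_character ρ hirr⟩ 1, ?_⟩
    rw [Finset.sum_eq_single ⟨_, isIrrChar_character ρ hirr⟩]
    · simp [Pi.single_eq_same]
    · intro χ _ hχ
      simp [Pi.single_eq_of_ne hχ]
    · exact fun h => absurd (Finset.mem_univ _) h
  by_cases hV : Subsingleton V
  · refine ⟨0, ?_⟩
    ext g
    have : ρ g = 0 := Subsingleton.elim _ _
    simp [Representation.character, this]
  have hnt : Nontrivial V := not_subsingleton_iff_nontrivial.mp hV
  have hnt' : Nontrivial (Subrepresentation ρ) :=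
    ⟨⊥, ⊤, fun h => bot_ne_top (congrArg Subrepresentation.toSubmodule h)⟩
  obtain ⟨S, hS0, hS1⟩ : ∃ S : Subrepresentation ρ, S ≠ ⊥ ∧ S ≠ ⊤ := by
    by_contra! hcon
    exact hirr ⟨fun S => or_iff_not_imp_left.mpr (hcon S)⟩
  obtain ⟨T, hT⟩ := exists_isCompl S
  have hc : IsCompl S.toSubmodule T.toSubmodule := by
    refine IsCompl.of_eq ?_ ?_
    · exact congrArg Subrepresentation.toSubmodule hT.inf_eq_bot
    · exact congrArg Subrepresentation.toSubmodule hT.sup_eq_top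
  have hSb : S.toSubmodule ≠ ⊥ := fun h => hS0 (Subrepresentation.toSubmodule_injective h)
  have hSt : S.toSubmodule ≠ ⊤ := fun h => hS1 (Subrepresentation.toSubmodule_injective h)
  have hadd := Submodule.finrank_add_eq_of_isCompl hc
  have hS' := Submodule.finrank_lt hSt
  have hSpos : 0 < Module.finrank ℂ S.toSubmodule :=
    Nat.pos_of_ne_zero fun h => hSb (Submodule.finrank_eq_zero.mp h)
  obtain ⟨a, ha⟩ := ih _ (by omega) S.toRepresentation rfl
  obtain ⟨b, hb⟩ := ih _ (by omega) T.toRepresentation rfl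
  refine ⟨a + b, ?_⟩
  have hsum : ρ.character = S.toRepresentation.character + T.toRepresentation.character := by
    ext g
    have he : ρ g = (Submodule.prodEquivOfIsCompl _ _ hc).conj
        ((S.toRepresentation g).prodMap (T.toRepresentation g)) := by
      ext v
      obtain ⟨⟨x, y⟩, rfl⟩ := (Submodule.prodEquivOfIsCompl _ _ hc).surjective v
      simp [LinearEquiv.conj_apply, Subrepresentation.toRepresentation]
    simp only [Representation.character, Pi.add_apply]
    rw [he, LinearMap.trace_conj', LinearMap.trace_prodMap']
  rw [hsum, ha, hb, ← Finset.sum_add_distrib]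
  simp [add_smul]

variable {G : Type*} [Group G] [Finite G] {V : Type*} [AddCommGroup V] [Module ℂ V]
  [FiniteDimensional ℂ V]

/-- There is exactly one integer matrix `(m_ij)` with `χ_γ · χ_i = ∑_j m_ij χ_j` for all `i`. -/
theorem existsUnique_mcKayMatrix (γ : Representation ℂ G V) :
    ∃! M : Matrix (Irr G) (Irr G) ℤ,
      ∀ i : Irr G, γ.character * i.1 = ∑ j : Irr G, (M i j : ℂ) • j.1 := by
  have h : ∀ i : Irr G, ∃ m : Irr G → ℕ, γ.character * i.1 = ∑ j : Irr G, (m j : ℂ) • j.1 := by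
    rintro ⟨_, d, ρ, hρ, rfl⟩
    obtain ⟨m, hm⟩ := exists_multiplicities _ (γ.tprod ρ) rfl
    exact ⟨m, by rw [← hm, char_tensor]⟩
  choose m hm using h
  refine ⟨Matrix.of fun i j => (m i j : ℤ), fun i => by simpa using hm i, ?_⟩
  intro N hN
  ext i j
  have h0 : ∑ j : Irr G, ((N i j : ℂ) - (m i j : ℂ)) • j.1 = 0 := by
    simp_rw [sub_smul, Finset.sum_sub_distrib]
    rw [← hN i, ← hm i, sub_self]
  have h1 := Fintype.linearIndependent_iff.mp (linearIndependent_irr G) _ h0 j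
  have h2 : (N i j : ℂ) = ((m i j : ℤ) : ℂ) := by simpa [sub_eq_zero] using h1
  exact_mod_cast h2

/-- The matrix `M = (m_ij)` determined by `χ_γ · χ_i = ∑_j m_ij χ_j`. -/
def mcKayMatrix (γ : Representation ℂ G V) : Matrix (Irr G) (Irr G) ℤ :=
  (existsUnique_mcKayMatrix γ).choose

/-- The defining equations of `M`. -/
theorem mcKayMatrix_spec (γ : Representation ℂ G V) (i : Irr G) :
    γ.character * i.1 = ∑ j : Irr G, (mcKayMatrix γ i j : ℂ) • j.1 :=
  (existsUnique_mcKayMatrix γ).choose_spec.1 i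

/-- The extended McKay-Cartan matrix `n I - M`, where `n = dim γ`. -/
def extMcKayCartan (γ : Representation ℂ G V) : Matrix (Irr G) (Irr G) ℤ :=
  (Module.finrank ℂ V : ℤ) • (1 : Matrix (Irr G) (Irr G) ℤ) - mcKayMatrix γ

/-- The McKay-Cartan matrix `C`: the extended matrix with the row and the column of the trivial
character removed. -/
def mcKayCartan (γ : Representation ℂ G V) :
    Matrix {χ : Irr G // χ ≠ trivialChar G} {χ : Irr G // χ ≠ trivialChar G} ℤ :=
  (extMcKayCartan γ).submatrix Subtype.val Subtype.val

/-- The critical group `K(γ) = coker (Cᵗ)`. -/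
abbrev K (γ : Representation ℂ G V) : Type _ :=
  ({χ : Irr G // χ ≠ trivialChar G} → ℤ) ⧸ LinearMap.range (mcKayCartan γ).transpose.mulVecLin

end CriticalGroup

end

/-!
Let `L = n I - M` be the extended matrix and `X` the character table. Columns of `X` are
eigenvectors of `L`: the one at `g` has eigenvalue `n - χ_γ(g)`. Column orthogonality makes `X`
invertible with an explicit inverse, so `L = X D X⁻¹` with `D` diagonal. It comes from two facts: a
class sum acts on an irreducible representation by a scalar (`Irr.sum_conj_mul`), and each
irreducible character occurs in the regular representation as often as its degree
(`sum_degree_mul_irr`).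

For (i), `det C` is the entry of `adj L = X adj(D) X⁻¹` at the trivial character. Since `D` vanishes
at the class of `1`, this entry is the product over the other classes divided by `|G|`
(`det_mcKayCartan`). Faithfulness makes every factor nonzero, as `χ_γ(g)` is a sum of `n` roots of
unity. Classes of mutually inverse elements give conjugate factors, so the product is positive
(`prod_eq_prod_norm`). The order of the cokernel of an integer matrix is the absolute value of its
determinant.

For (ii), put `k = n - χ_γ(c)`. Differences of columns of `X` at classes where `χ_γ` takes this value
vanish at the trivial character, hence restrict to eigenvectors of `C`, and the `k`-eigenspace of
`C`, or of `Cᵗ`, has dimension at least `m - 1`. The integral eigenlattice `Λ` of `Cᵗ` has at least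
this rank (`finrank_ker_map_le`). Since `Cᵗ` is injective, `Λ / k Λ` embeds in the cokernel
(`exists_subgroup_coker_of_eigenlattice`).
-/

namespace CriticalGroup

open Module Representation

/-! ### Integer matrices: cokernels and kernels -/

section IntegerMatrix

variable {ι : Type*} [Fintype ι]

/-- If the `ℤ`-kernel of an integer matrix has rank `r`, then its complex kernel has dimension at
most `r`. The coordinates of a complex kernel vector generate a free abelian group `S` of finite
rank, and the components of the vector along a `ℤ`-basis of `S` are integral kernel vectors. -/
theorem finrank_ker_map_le (A : Matrix ι ι ℤ) :
    finrank ℂ (LinearMap.ker (A.map (Int.cast : ℤ → ℂ)).mulVecLin) ≤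
      finrank ℤ (LinearMap.ker A.mulVecLin) := by
  classical
  let b := Module.finBasis ℤ (LinearMap.ker A.mulVecLin)
  let castV : (ι → ℤ) →ₗ[ℤ] (ι → ℂ) := (Algebra.linearMap ℤ ℂ).compLeft ι
  let B : Set (ι → ℂ) := Set.range fun k => castV (b k : ι → ℤ)
  have hmem : ∀ a ∈ LinearMap.ker A.mulVecLin, castV a ∈ Submodule.span ℂ B := by
    intro a ha
    have h := b.sum_repr ⟨a, ha⟩
    have h' : a = ∑ k, (b.repr ⟨a, ha⟩ k) • (b k : ι → ℤ) := by
      simpa [-Basis.sum_repr] using (congrArg Subtype.val h).symm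
    rw [h', map_sum]
    refine Submodule.sum_mem _ fun k _ => ?_
    rw [map_smul]
    exact Submodule.smul_of_tower_mem _ _ (Submodule.subset_span ⟨k, rfl⟩)
  have hle : LinearMap.ker (A.map (Int.cast : ℤ → ℂ)).mulVecLin ≤ Submodule.span ℂ B := by
    intro v hv
    let S : Submodule ℤ ℂ := Submodule.span ℤ (Set.range v)
    have : Module.Finite ℤ S := Module.Finite.span_of_finite ℤ (Set.finite_range v)
    let e := Module.finBasis ℤ S
    let w : ι → S := fun i => ⟨v i, Submodule.subset_span ⟨i, rfl⟩⟩
    let a : Fin (finrank ℤ S) → ι → ℤ := fun t i => e.repr (w i) t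
    have ha : ∀ t, a t ∈ LinearMap.ker A.mulVecLin := by
      intro t
      rw [LinearMap.mem_ker]
      funext i
      have hsum : ∑ j, A i j • w j = 0 := by
        apply Subtype.ext
        have := congrFun (LinearMap.mem_ker.mp hv) i
        simpa [Matrix.mulVec, dotProduct, w] using this
      have := congrArg (fun s => e.repr s t) hsum
      simpa [Matrix.mulVec, dotProduct, a] using this
    have hv' : v = ∑ t, (e t : ℂ) • castV (a t) := by
      funext i
      have := congrArg Subtype.val (e.sum_repr (w i))
      simpa [-Basis.sum_repr, castV, a, w, mul_comm] using this.symm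
    rw [hv']
    exact Submodule.sum_mem _ fun t _ => Submodule.smul_mem _ _ (hmem _ (ha t))
  calc _ ≤ finrank ℂ (Submodule.span ℂ B) := Submodule.finrank_mono hle
    _ ≤ _ := by
      have := finrank_range_le_card (R := ℂ) fun k => castV (b k : ι → ℤ)
      simpa [Set.finrank, B] using this

variable [DecidableEq ι]

theorem mulVecLin_injective_of_det_ne_zero (A : Matrix ι ι ℤ) (hA : A.det ≠ 0) :
    Function.Injective A.mulVecLin := by
  rw [← LinearMap.ker_eq_bot, LinearMap.ker_eq_bot']
  intro v hv
  by_contra hne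
  exact hA (Matrix.exists_mulVec_eq_zero_iff.mp ⟨v, hne, hv⟩)

theorem natCard_coker_eq_natAbs_det (A : Matrix ι ι ℤ) (hA : A.det ≠ 0) :
    Nat.card ((ι → ℤ) ⧸ LinearMap.range A.mulVecLin) = A.det.natAbs := by
  have hinj := mulVecLin_injective_of_det_ne_zero A hA
  rw [← Submodule.natAbs_det_equiv _ (LinearEquiv.ofInjective _ hinj), ← LinearMap.det_toLin']
  rfl

/-- An eigenlattice `Λ` of an injective integer matrix `A` for an eigenvalue `k` meets the image of
`A` exactly in `k Λ`: if `u = A w` lies in `Λ`, then `A u = k u = A (k w)`, hence `u = k w`. So a free part of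
rank `r` of `Λ` contributes a subgroup `(ℤ/k)^r` of the cokernel. This includes `k = 0`, where `Λ = 0`. -/
theorem exists_subgroup_coker_of_eigenlattice (A : Matrix ι ι ℤ) (hA : A.det ≠ 0) (k : ℤ) (r : ℕ)
    (hr : r ≤ finrank ℤ (LinearMap.ker (A - k • (1 : Matrix ι ι ℤ)).mulVecLin)) :
    ∃ H : AddSubgroup ((ι → ℤ) ⧸ LinearMap.range A.mulVecLin),
      Nonempty (H ≃+ (Fin r → ZMod k.natAbs)) := by
  have hinj := mulVecLin_injective_of_det_ne_zero A hA
  set Λ := LinearMap.ker (A - k • (1 : Matrix ι ι ℤ)).mulVecLin with hΛ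
  have memΛ : ∀ u, u ∈ Λ ↔ A.mulVecLin u = k • u := by
    intro u
    rw [hΛ, LinearMap.mem_ker, Matrix.mulVecLin_apply, Matrix.sub_mulVec, sub_eq_zero,
      Matrix.smul_mulVec, Matrix.one_mulVec, Matrix.mulVecLin_apply]
  let b := Module.finBasis ℤ Λ
  let f : (Fin r → ℤ) →ₗ[ℤ] Λ := Fintype.linearCombination ℤ fun i : Fin r => b (Fin.castLE hr i)
  let p : (Fin r → ℤ) →ₗ[ℤ] ((ι → ℤ) ⧸ LinearMap.range A.mulVecLin) :=
    (Submodule.mkQ _) ∘ₗ Λ.subtype ∘ₗ f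
  let q : (Fin r → ℤ) →+ (Fin r → ZMod k.natAbs) :=
    (Int.castAddHom (ZMod k.natAbs)).compLeft (Fin r)
  have hq : Function.Surjective q := fun y =>
    ⟨fun i => (ZMod.intCast_surjective (y i)).choose,
      funext fun i => (ZMod.intCast_surjective (y i)).choose_spec⟩
  have hker : p.toAddMonoidHom.ker = q.ker := by
    ext x
    have h1 : x ∈ q.ker ↔ ∃ y : Fin r → ℤ, x = k • y := by
      rw [AddMonoidHom.mem_ker]
      constructor
      · intro h
        have h' : ∀ i, k ∣ x i := fun i => by
          have := congrFun h i
          have h2 : ((x i : ℤ) : ZMod k.natAbs) = 0 := this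
          rwa [ZMod.intCast_zmod_eq_zero_iff_dvd, Int.natCast_natAbs, abs_dvd] at h2
        choose y hy using h'
        exact ⟨y, funext hy⟩
      · rintro ⟨y, rfl⟩
        funext i
        change (((k • y) i : ℤ) : ZMod k.natAbs) = 0
        rw [ZMod.intCast_zmod_eq_zero_iff_dvd, Int.natCast_natAbs, abs_dvd]
        exact ⟨y i, rfl⟩
    rw [h1, AddMonoidHom.mem_ker]
    change p x = 0 ↔ _
    have h2 : p x = 0 ↔ ∃ w, A.mulVecLin w = (f x : ι → ℤ) := by
      simp [p, Submodule.Quotient.mk_eq_zero]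
    rw [h2]
    constructor
    · rintro ⟨w, hw⟩
      have hx := (memΛ _).mp (f x).2
      have hkw : (f x : ι → ℤ) = k • w := by
        apply hinj
        rw [map_smul, hx, hw]
      have hw' : w ∈ Λ := (memΛ w).mpr (hw.trans hkw)
      have hf : f x = k • (⟨w, hw'⟩ : Λ) := Subtype.ext hkw
      refine ⟨fun i => b.repr ⟨w, hw'⟩ (Fin.castLE hr i), funext fun i => ?_⟩
      have h3 : b.repr (f x) (Fin.castLE hr i) = x i := by
        simp [f, Fintype.linearCombination_apply, Finsupp.single_apply,
          (Fin.castLE_injective hr).eq_iff]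
      rw [← h3, hf, map_smul]
      rfl
    · rintro ⟨y, rfl⟩
      exact ⟨f y, by rw [(memΛ _).mp (f y).2, map_smul]; rfl⟩
  exact ⟨p.toAddMonoidHom.range, ⟨(QuotientAddGroup.quotientKerEquivRange _).symm.trans
    ((QuotientAddGroup.quotientAddEquivOfEq hker).trans
      (QuotientAddGroup.quotientKerEquivOfSurjective q hq))⟩⟩

end IntegerMatrix

/-! ### Values of characters -/

section Eigenbasis

variable {V : Type*} [AddCommGroup V] [Module ℂ V]

theorem trace_eq_sum_of_eigenbasis {ι : Type*} [Fintype ι] (b : Basis ι ℂ V) (f : End ℂ V)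
    (μ : ι → ℂ) (h : ∀ i, f (b i) = μ i • b i) : LinearMap.trace ℂ V f = ∑ i, μ i := by
  classical
  rw [LinearMap.trace_eq_matrix_trace ℂ b, Matrix.trace]
  exact Finset.sum_congr rfl fun i _ => by simp [LinearMap.toMatrix_apply, h]

variable [FiniteDimensional ℂ V]

/-- A complex endomorphism of finite order is diagonalizable, since `X ^ N - 1` is separable. -/
theorem exists_eigenbasis_of_pow_eq_one (f : End ℂ V) {N : ℕ} (hN : N ≠ 0) (hf : f ^ N = 1) :
    ∃ (b : Basis (Fin (finrank ℂ V)) ℂ V) (μ : Fin (finrank ℂ V) → ℂ),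
      ∀ i, f (b i) = μ i • b i := by
  classical
  have hsep : (Polynomial.X ^ N - 1 : Polynomial ℂ).Separable :=
    Polynomial.X_pow_sub_one_separable_iff.mpr (Nat.cast_ne_zero.mpr hN)
  have hss : f.IsSemisimple :=
    Module.End.isSemisimple_of_squarefree_aeval_eq_zero hsep.squarefree (by simp [hf])
  have htop : ⨆ μ, f.eigenspace μ = ⊤ := by
    simp_rw [← hss.isFinitelySemisimple.maxGenEigenspace_eq_eigenspace]
    exact Module.End.iSup_maxGenEigenspace_eq_top f
  have hint := DirectSum.isInternal_submodule_of_iSupIndep_of_iSup_eq_top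
    f.eigenspaces_iSupIndep htop
  let b := hint.collectedBasis fun μ => Module.finBasis ℂ (f.eigenspace μ)
  have : Fintype ((μ : ℂ) × Fin (finrank ℂ (f.eigenspace μ))) :=
    FiniteDimensional.fintypeBasisIndex b
  let e : ((μ : ℂ) × Fin (finrank ℂ (f.eigenspace μ))) ≃ Fin (finrank ℂ V) :=
    Fintype.equivFinOfCardEq (Module.finrank_eq_card_basis b).symm
  refine ⟨b.reindex e, fun i => (e.symm i).1, fun i => ?_⟩
  rw [Basis.reindex_apply]
  exact Module.End.mem_eigenspace_iff.mp (hint.collectedBasis_mem _ (e.symm i))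

end Eigenbasis

section Values

variable {G : Type*} [Group G] [Finite G] {V : Type*} [AddCommGroup V] [Module ℂ V]
  [FiniteDimensional ℂ V]

theorem exists_eigenbasis (γ : Representation ℂ G V) (g : G) :
    ∃ (b : Basis (Fin (finrank ℂ V)) ℂ V) (μ : Fin (finrank ℂ V) → ℂ),
      (∀ i, γ g (b i) = μ i • b i) ∧ (∀ i, γ g⁻¹ (b i) = (μ i)⁻¹ • b i) ∧ ∀ i, ‖μ i‖ = 1 := by
  have hN : orderOf g ≠ 0 := (orderOf_pos g).ne'
  have hpow : γ g ^ orderOf g = 1 := by rw [← map_pow, pow_orderOf_eq_one, map_one]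
  obtain ⟨b, μ, hb⟩ := exists_eigenbasis_of_pow_eq_one (γ g) hN hpow
  have hμ : ∀ i, μ i ^ orderOf g = 1 := by
    intro i
    have h1 : ∀ k : ℕ, (γ g ^ k) (b i) = μ i ^ k • b i := by
      intro k
      induction k with
      | zero => simp
      | succ k ih => rw [pow_succ, Module.End.mul_apply, hb, map_smul, ih, smul_smul, pow_succ']
    have h2 := h1 (orderOf g)
    rw [hpow, Module.End.one_apply] at h2
    have h3 : (μ i ^ orderOf g - 1) • b i = 0 := by rw [sub_smul, ← h2, one_smul, sub_self]
    exact sub_eq_zero.mp ((smul_eq_zero.mp h3).resolve_right (b.ne_zero i))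
  have hnorm : ∀ i, ‖μ i‖ = 1 := fun i => Complex.norm_eq_one_of_pow_eq_one (hμ i) hN
  refine ⟨b, μ, hb, fun i => ?_, hnorm⟩
  have h0 : μ i ≠ 0 := fun h => by simpa [h] using hnorm i
  have h1 : γ g⁻¹ (γ g (b i)) = b i := by
    rw [← Module.End.mul_apply, ← map_mul, inv_mul_cancel, map_one, Module.End.one_apply]
  rw [hb, map_smul] at h1
  rw [← inv_smul_smul₀ h0 (γ g⁻¹ (b i)), h1]

theorem character_inv_eq_conj (γ : Representation ℂ G V) (g : G) :
    γ.character g⁻¹ = (starRingEnd ℂ) (γ.character g) := by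
  obtain ⟨b, μ, h, h', hnorm⟩ := exists_eigenbasis γ g
  rw [character, character, trace_eq_sum_of_eigenbasis b _ _ h, trace_eq_sum_of_eigenbasis b _ _ h',
    map_sum]
  exact Finset.sum_congr rfl fun i _ => Complex.inv_eq_conj (hnorm i)

theorem character_re_le (γ : Representation ℂ G V) (g : G) :
    (γ.character g).re ≤ finrank ℂ V := by
  obtain ⟨b, μ, h, -, hnorm⟩ := exists_eigenbasis γ g
  rw [character, trace_eq_sum_of_eigenbasis b _ _ h, Complex.re_sum]
  calc _ ≤ ∑ _i : Fin (finrank ℂ V), (1 : ℝ) :=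
        Finset.sum_le_sum fun i _ => (Complex.re_le_norm _).trans (hnorm i).le
    _ = _ := by simp

/-- A sum of `dim V` complex numbers of norm `1` equals `dim V` only if all of them are `1`. -/
theorem eq_one_of_character_eq_finrank (γ : Representation ℂ G V) (hγ : Function.Injective γ)
    (g : G) (hg : γ.character g = finrank ℂ V) : g = 1 := by
  obtain ⟨b, μ, h, -, hnorm⟩ := exists_eigenbasis γ g
  have hle : ∀ i ∈ Finset.univ, (μ i).re ≤ 1 := fun i _ =>
    (Complex.re_le_norm _).trans (hnorm i).le
  have hsum : ∑ i, (μ i).re = ∑ _i : Fin (finrank ℂ V), (1 : ℝ) := by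
    rw [← Complex.re_sum, ← trace_eq_sum_of_eigenbasis b _ _ h]
    change (γ.character g).re = _
    simp [hg]
  have hre := (Finset.sum_eq_sum_iff_of_le hle).mp hsum
  apply hγ
  rw [map_one]
  refine b.ext fun i => ?_
  have h1 : μ i = 1 := by
    have h2 := hre i (Finset.mem_univ i)
    have h3 : (μ i).re = ‖μ i‖ := by rw [h2, hnorm]
    have h4 := Complex.re_eq_norm.mp h3
    have h5 := (Complex.nonneg_iff.mp h4).2
    exact Complex.ext (by simpa using h2) (by simpa using h5.symm)
  rw [h, h1, one_smul, Module.End.one_apply]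

end Values

/-! ### Orthogonality of irreducible characters -/

section Orthogonality

variable {G : Type*} [Group G]

theorem Irr.val_conj (χ : Irr G) (x g : G) : χ.1 (x * g * x⁻¹) = χ.1 g := by
  obtain ⟨_, d, ρ, hρ, rfl⟩ := χ
  exact ρ.char_conj g x

theorem character_eq_of_isConj {V : Type*} [AddCommGroup V] [Module ℂ V]
    (ρ : Representation ℂ G V) {g h : G} (hgh : IsConj g h) : ρ.character g = ρ.character h := by
  obtain ⟨x, rfl⟩ := isConj_iff.mp hgh
  exact (ρ.char_conj g x).symm

variable [Fintype G]

theorem row_orthogonality (χ ψ : Irr G) :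
    ∑ g : G, χ.1 g * ψ.1 g⁻¹ = if χ = ψ then (Nat.card G : ℂ) else 0 := by
  classical
  have hG : (Nat.card G : ℂ) ≠ 0 := by simp
  have : Invertible (Nat.card G : ℂ) := invertibleOfNonzero hG
  obtain ⟨_, d, ρ, hρ, rfl⟩ := χ
  obtain ⟨_, d', σ, hσ, rfl⟩ := ψ
  have h12 := Representation.char_orthonormal ρ σ
  rw [inv_mul_eq_iff_eq_mul₀ hG] at h12
  rw [h12]
  by_cases h : Nonempty (Representation.Equiv σ ρ)
  · have : ρ.character = σ.character := (char_iso h.some).symm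
    simp [h, this]
  · have hne : ρ.character ≠ σ.character := fun heq => by
      have h22 := Representation.char_orthonormal σ σ
      rw [if_pos ⟨Representation.Equiv.refl σ⟩, inv_mul_eq_iff_eq_mul₀ hG] at h22
      rw [if_neg h, heq, h22] at h12
      simp at h12
    rw [if_neg h, if_neg fun he => hne (congrArg Irr.val he), mul_zero]

/-- By Schur's lemma the sum of `ρ (x g x⁻¹)` over `x` is a scalar. Its trace gives the
scalar, and the trace of its product with `ρ h` gives the formula. -/
theorem Irr.sum_conj_mul (χ : Irr G) (g h : G) :
    χ.1 1 * ∑ x : G, χ.1 (x * g * x⁻¹ * h) = Nat.card G * (χ.1 g * χ.1 h) := by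
  obtain ⟨_, d, ρ, hρ, rfl⟩ := χ
  let T : (Fin d → ℂ) →ₗ[ℂ] (Fin d → ℂ) := ∑ x : G, ρ (x * g * x⁻¹)
  have hT : ∀ y, T ∘ₗ ρ y = ρ y ∘ₗ T := by
    intro y
    change T * ρ y = ρ y * T
    simp only [T, Finset.sum_mul, Finset.mul_sum, ← map_mul]
    refine Fintype.sum_equiv (Equiv.mulLeft y⁻¹) _ _ fun x => ?_
    simp [mul_assoc]
  obtain ⟨s, hs⟩ :=
    (IsIrreducible.algebraMap_intertwiningMap_bijective_of_isAlgClosed (ρ := ρ)).2 ⟨T, hT⟩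
  have hTs : T = s • 1 := by
    have := congrArg IntertwiningMap.toLinearMap hs
    exact this.symm
  have h1 : (Nat.card G : ℂ) * ρ.character g = s * ρ.character 1 := by
    have := congrArg (LinearMap.trace ℂ _) hTs
    simp only [T, map_sum, map_smul] at this
    rw [character, character, map_one, ← smul_eq_mul s, ← this]
    have h2 : ∀ x, LinearMap.trace ℂ _ (ρ (x * g * x⁻¹)) = LinearMap.trace ℂ _ (ρ g) :=
      fun x => ρ.char_conj g x
    rw [Finset.sum_congr rfl fun x _ => h2 x]
    simp
  have h2 : ∑ x : G, ρ.character (x * g * x⁻¹ * h) = s * ρ.character h := by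
    have := congrArg (fun f => LinearMap.trace ℂ _ (f * ρ h)) hTs
    simp only [T, Finset.sum_mul, map_sum, ← map_mul, smul_mul_assoc, one_mul, map_smul] at this
    exact this
  change ρ.character 1 * ∑ x : G, ρ.character (x * g * x⁻¹ * h) = _ * (ρ.character g * ρ.character h)
  rw [h2, ← mul_assoc _ (ρ.character g), h1]
  ring

/-- The regular representation of `G` on functions by right translation. -/
def regular (G : Type*) [Group G] : Representation ℂ G (G → ℂ) where
  toFun g := LinearMap.funLeft ℂ ℂ (· * g)
  map_one' := by ext; simp
  map_mul' g h := by
    refine LinearMap.ext fun f => funext fun x => ?_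
    simp [LinearMap.funLeft, mul_assoc]

theorem regular_character [DecidableEq G] (g : G) :
    (regular G).character g = if g = 1 then (Nat.card G : ℂ) else 0 := by
  rw [character, LinearMap.trace_eq_matrix_trace ℂ (Pi.basisFun ℂ G), Matrix.trace]
  have : ∀ x : G, (LinearMap.toMatrix (Pi.basisFun ℂ G) (Pi.basisFun ℂ G) (regular G g)).diag x =
      if g = 1 then 1 else 0 := by
    intro x
    simp [regular, LinearMap.funLeft, Pi.single_apply]
  rw [Finset.sum_congr rfl fun x _ => this x]
  simp

/-- The irreducible character `χ` occurs in the regular character with multiplicity `χ(1)`. -/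
theorem sum_degree_mul_irr [DecidableEq G] (g : G) :
    ∑ χ : Irr G, χ.1 1 * χ.1 g = if g = 1 then (Nat.card G : ℂ) else 0 := by
  have hG : (Nat.card G : ℂ) ≠ 0 := by simp
  obtain ⟨m, hm⟩ := exists_multiplicities _ (regular G) rfl
  have key : ∀ ψ : Irr G, (m ψ : ℂ) = ψ.1 1 := by
    intro ψ
    have h1 : ∑ g : G, (regular G).character g * ψ.1 g⁻¹ = Nat.card G * ψ.1 1 := by
      simp [regular_character]
    rw [hm] at h1
    simp only [Finset.sum_apply, Pi.smul_apply, smul_eq_mul, Finset.sum_mul, mul_assoc] at h1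
    rw [Finset.sum_comm] at h1
    simp only [← Finset.mul_sum, row_orthogonality] at h1
    simp only [mul_ite, mul_zero, Finset.sum_ite_eq', Finset.mem_univ, if_true] at h1
    rw [mul_comm] at h1
    exact mul_left_cancel₀ hG h1
  rw [← regular_character, hm]
  simp [key]

theorem column_orthogonality [DecidableEq G] (g h : G) :
    ∑ χ : Irr G, χ.1 h⁻¹ * χ.1 g = (Finset.univ.filter fun x : G => x * g * x⁻¹ = h).card := by
  have hG : (Nat.card G : ℂ) ≠ 0 := by simp
  apply mul_left_cancel₀ hG
  rw [Finset.mul_sum]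
  simp_rw [mul_comm (Irr.val _ h⁻¹), ← Irr.sum_conj_mul, Finset.mul_sum]
  rw [Finset.sum_comm]
  simp_rw [sum_degree_mul_irr, mul_inv_eq_one]
  rw [← Finset.sum_filter]
  simp [mul_comm]

end Orthogonality

/-! ### Spectrum of the McKay-Cartan matrices -/

section Spectrum

variable {G : Type*} [Group G] [Finite G]

/-- Columns of the character table at pairwise non-conjugate elements are linearly independent. -/
theorem linearIndependent_columns {T : Type*} [Fintype T] (g : T → G)
    (hg : Function.Injective fun t => ConjClasses.mk (g t)) :
    LinearIndependent ℂ fun (t : T) (χ : Irr G) => χ.1 (g t) := by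
  classical
  have := Fintype.ofFinite G
  rw [Fintype.linearIndependent_iff]
  intro a ha s
  have h1 : ∑ χ : Irr G, χ.1 (g s)⁻¹ * ∑ t, a t * χ.1 (g t) = 0 := by
    refine Finset.sum_eq_zero fun χ _ => ?_
    have : ∑ t, a t * χ.1 (g t) = 0 := by simpa using congrFun ha χ
    rw [this, mul_zero]
  simp_rw [Finset.mul_sum, mul_left_comm _ (a _)] at h1
  rw [Finset.sum_comm] at h1
  simp_rw [← Finset.mul_sum, column_orthogonality] at h1
  rw [Finset.sum_eq_single s] at h1
  · refine (mul_eq_zero.mp h1).resolve_right (Nat.cast_ne_zero.mpr (Finset.card_ne_zero.mpr ?_))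
    exact ⟨1, by simp⟩
  · intro t _ hts
    rw [Finset.card_eq_zero.mpr, Nat.cast_zero, mul_zero]
    refine Finset.filter_eq_empty_iff.mpr fun x _ hx => hts (hg ?_)
    exact ConjClasses.mk_eq_mk_iff_isConj.mpr (isConj_iff.mpr ⟨x, hx⟩)
  · exact fun h => absurd (Finset.mem_univ _) h

/-- There are as many irreducible characters as conjugacy classes. -/
theorem card_irr_eq {T : Type*} [Fintype T] (c : T → G)
    (hc : Function.Bijective fun t => ConjClasses.mk (c t)) :
    Fintype.card (Irr G) = Fintype.card T := by
  apply le_antisymm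
  · have hli : LinearIndependent ℂ fun (χ : Irr G) (t : T) => χ.1 (c t) := by
      rw [Fintype.linearIndependent_iff]
      intro a ha
      refine Fintype.linearIndependent_iff.mp (linearIndependent_irr G) a (funext fun x => ?_)
      obtain ⟨t, ht⟩ := hc.2 (ConjClasses.mk x)
      obtain ⟨y, rfl⟩ := isConj_iff.mp (ConjClasses.mk_eq_mk_iff_isConj.mp ht)
      simpa [Irr.val_conj] using congrFun ha t
    simpa using hli.fintype_card_le_finrank
  · simpa using (linearIndependent_columns c hc.1).fintype_card_le_finrank

variable {V : Type*} [AddCommGroup V] [Module ℂ V] [FiniteDimensional ℂ V]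

/-- The columns of the character table are eigenvectors of the extended McKay-Cartan matrix. -/
theorem extMcKayCartan_mulVec (γ : Representation ℂ G V) (g : G) (χ : Irr G) :
    ∑ ψ : Irr G, (extMcKayCartan γ χ ψ : ℂ) * ψ.1 g =
      (finrank ℂ V - γ.character g) * χ.1 g := by
  have h := congrFun (mcKayMatrix_spec γ χ) g
  simp only [Pi.mul_apply, Finset.sum_apply, Pi.smul_apply, smul_eq_mul] at h
  have hentry : ∀ ψ, (extMcKayCartan γ χ ψ : ℂ) =
      (if χ = ψ then (finrank ℂ V : ℂ) else 0) - mcKayMatrix γ χ ψ := by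
    intro ψ
    rw [extMcKayCartan, Matrix.sub_apply, Matrix.smul_apply, Matrix.one_apply]
    split_ifs <;> simp
  rw [sub_mul, h]
  simp [hentry, sub_mul, Finset.sum_sub_distrib]

/-- Expanding along the row of the trivial character, the minor `det C` is a diagonal entry of the
adjugate of `L = n I - M`. With `L = X D X⁻¹` for the character table `X`, that adjugate is
`X adj(D) X⁻¹`. As `D` has a zero at the class of `1`, only one entry of `adj(D)` is nonzero. -/
theorem det_mcKayCartan (γ : Representation ℂ G V) (ℓ : ℕ) (c : Fin (ℓ + 1) → G) (hc₀ : c 0 = 1)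
    (hc : Function.Bijective fun i => ConjClasses.mk (c i)) :
    ((mcKayCartan γ).det : ℂ) =
      (Nat.card G : ℂ)⁻¹ * ∏ i : Fin ℓ, ((finrank ℂ V : ℂ) - γ.character (c i.succ)) := by
  classical
  have := Fintype.ofFinite G
  let t := trivialChar G
  let e : Irr G ≃ Fin (ℓ + 1) := Fintype.equivOfCardEq (card_irr_eq c hc)
  let L : Matrix (Irr G) (Irr G) ℂ := (extMcKayCartan γ).map (Int.cast : ℤ → ℂ)
  let X : Matrix (Irr G) (Irr G) ℂ := Matrix.of fun χ j => χ.1 (c (e j))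
  let d : Irr G → ℂ := fun j => finrank ℂ V - γ.character (c (e j))
  -- the order of the centralizer of `c (e j)`
  let z : Irr G → ℂ := fun j =>
    ((Finset.univ.filter fun x : G => x * c (e j) * x⁻¹ = c (e j)).card : ℂ)
  let Y : Matrix (Irr G) (Irr G) ℂ := Matrix.of fun i χ => (z i)⁻¹ * χ.1 (c (e i))⁻¹
  have hz : ∀ j, z j ≠ 0 := fun j =>
    Nat.cast_ne_zero.mpr (Finset.card_ne_zero.mpr ⟨1, by simp⟩)
  have hYX : Y * X = 1 := by
    ext i j
    have hentry : (Y * X) i j = (z i)⁻¹ *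
        ((Finset.univ.filter fun x : G => x * c (e j) * x⁻¹ = c (e i)).card : ℂ) := by
      rw [← column_orthogonality (c (e j)) (c (e i)), Finset.mul_sum, Matrix.mul_apply]
      exact Finset.sum_congr rfl fun χ _ => mul_assoc _ _ _
    rw [hentry]
    by_cases hij : i = j
    · subst hij
      rw [Matrix.one_apply_eq]
      exact inv_mul_cancel₀ (hz i)
    · rw [Matrix.one_apply_ne hij, Finset.card_eq_zero.mpr, Nat.cast_zero, mul_zero]
      refine Finset.filter_eq_empty_iff.mpr fun x _ hx => hij (e.injective (hc.1 ?_)).symm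
      exact ConjClasses.mk_eq_mk_iff_isConj.mpr (isConj_iff.mpr ⟨x, hx⟩)
  have hXY : X * Y = 1 := mul_eq_one_comm.mp hYX
  have hLX : L * X = X * Matrix.diagonal d := by
    ext χ j
    rw [Matrix.mul_diagonal, Matrix.mul_apply]
    exact (extMcKayCartan_mulVec γ (c (e j)) χ).trans (mul_comm _ _)
  have hL : L = X * Matrix.diagonal d * Y := by
    rw [← hLX, mul_assoc, hXY, mul_one]
  have hadjX : X.adjugate = X.det • Y := by
    rw [← one_mul X.adjugate, ← hYX, mul_assoc, Matrix.mul_adjugate, Matrix.mul_smul, mul_one]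
  have hadjY : Y.adjugate = Y.det • X := by
    rw [← one_mul Y.adjugate, ← hXY, mul_assoc, Matrix.mul_adjugate, Matrix.mul_smul, mul_one]
  have hadj : L.adjugate = X * (Matrix.diagonal d).adjugate * Y := by
    have hdet : Y.det * X.det = 1 := by rw [← Matrix.det_mul, hYX, Matrix.det_one]
    rw [hL, Matrix.adjugate_mul_distrib, Matrix.adjugate_mul_distrib, hadjX, hadjY,
      Matrix.mul_smul, Matrix.smul_mul, Matrix.mul_smul, smul_smul, hdet, one_smul, mul_assoc]
  have hminor : ((mcKayCartan γ).det : ℂ) = L.adjugate t t := by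
    rw [Matrix.adjugate_apply, Matrix.twoBlockTriangular_det _ (fun χ => χ ≠ t)]
    · have hone : ((L.updateRow t (Pi.single t 1)).toSquareBlockProp fun χ => ¬ χ ≠ t) = 1 := by
        ext ⟨χ, hχ⟩ ⟨ψ, hψ⟩
        obtain rfl := not_not.mp hχ
        obtain rfl := not_not.mp hψ
        simp [Matrix.toSquareBlockProp]
      rw [hone, Matrix.det_one, mul_one, Int.cast_det]
      congr 1
      ext ⟨χ, hχ⟩ ⟨ψ, hψ⟩
      change ((extMcKayCartan γ χ ψ : ℤ) : ℂ) = L.updateRow t (Pi.single t 1) χ ψ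
      rw [Matrix.updateRow_ne hχ]
      rfl
    · intro χ hχ ψ hψ
      obtain rfl := not_not.mp hχ
      simp [hψ]
  have h0 : d (e.symm 0) = 0 := by simp [d, hc₀]
  rw [hminor, hadj, Matrix.adjugate_diagonal, Matrix.mul_apply, Finset.sum_eq_single (e.symm 0)]
  · have hz0 : z (e.symm 0) = Nat.card G := by simp [z, hc₀]
    have ht : ∀ g, t.1 g = 1 := fun g => rfl
    rw [Matrix.mul_diagonal]
    have hprod : ∏ j ∈ Finset.univ.erase (e.symm 0), d j =
        ∏ i : Fin ℓ, ((finrank ℂ V : ℂ) - γ.character (c i.succ)) := by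
      rw [Finset.prod_equiv e (t := Finset.univ.erase 0)
          (g := fun i => (finrank ℂ V : ℂ) - γ.character (c i))
          (by simp [Equiv.eq_symm_apply]) (fun _ _ => rfl),
        Fin.univ_succ, Finset.erase_cons, Finset.prod_map]
      rfl
    simp only [X, Y, Matrix.of_apply, ht, hz0, hprod]
    ring
  · intro j _ hj
    rw [Matrix.mul_diagonal, Finset.prod_eq_zero (i := e.symm 0), mul_zero, zero_mul]
    · simpa using hj.symm
    · exact h0
  · exact fun h => absurd (Finset.mem_univ _) h

/-- The factors at a class and at the class of inverses are complex conjugate, and at a class closed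
under inversion the factor is real and nonnegative. So the phases `w / ‖w‖` of the factors cancel
in pairs, and the product is nonnegative. -/
theorem prod_eq_prod_norm (γ : Representation ℂ G V) (hγ : Function.Injective γ) (ℓ : ℕ)
    (c : Fin (ℓ + 1) → G) (hc₀ : c 0 = 1)
    (hc : Function.Bijective fun i => ConjClasses.mk (c i)) :
    ∏ i : Fin ℓ, ((finrank ℂ V : ℂ) - γ.character (c i.succ)) =
      ∏ i : Fin ℓ, (‖(finrank ℂ V : ℂ) - γ.character (c i.succ)‖ : ℂ) := by
  classical
  let w : Fin (ℓ + 1) → ℂ := fun i => finrank ℂ V - γ.character (c i)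
  let E := Equiv.ofBijective _ hc
  let σ : Fin (ℓ + 1) → Fin (ℓ + 1) := fun i => E.symm (ConjClasses.mk (c i)⁻¹)
  have hσ : ∀ i, IsConj (c (σ i)) (c i)⁻¹ := fun i =>
    ConjClasses.mk_eq_mk_iff_isConj.mp (E.apply_symm_apply (ConjClasses.mk (c i)⁻¹))
  have hinj : ∀ i j, IsConj (c i) (c j) → i = j := fun i j h =>
    hc.1 (ConjClasses.mk_eq_mk_iff_isConj.mpr h)
  have hinv : ∀ x y : G, IsConj x y → IsConj x⁻¹ y⁻¹ := by
    intro x y h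
    obtain ⟨u, rfl⟩ := isConj_iff.mp h
    exact isConj_iff.mpr ⟨u, by group⟩
  have hσσ : ∀ i, σ (σ i) = i := fun i => hinj _ _ <| by
    simpa using (hσ (σ i)).trans (hinv _ _ (hσ i))
  have hσ0 : ∀ i, σ i = 0 ↔ i = 0 := by
    have h0 : σ 0 = 0 := hinj _ _ (by simpa [hc₀] using hσ 0)
    exact fun i => ⟨fun h => by rw [← hσσ i, h, h0], fun h => by rw [h, h0]⟩
  have hw : ∀ i, w (σ i) = (starRingEnd ℂ) (w i) := fun i => by
    simp only [w, character_eq_of_isConj γ (hσ i), character_inv_eq_conj, map_sub, map_natCast]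
  have hw0 : ∀ i, i ≠ 0 → w i ≠ 0 := fun i hi h => hi <| by
    have := eq_one_of_character_eq_finrank γ hγ (c i) (sub_eq_zero.mp h).symm
    exact hinj _ _ (by rw [this, hc₀])
  -- the factor at the class of `1` is `0` and has no phase
  let f : Fin (ℓ + 1) → ℂ := fun i => if i = 0 then 1 else w i / ‖w i‖
  have hprod : ∏ i, f i = 1 := by
    refine Finset.prod_involution (fun i _ => σ i) ?_ ?_ (fun _ _ => Finset.mem_univ _)
      fun i _ => hσσ i
    · intro i _
      by_cases hi : i = 0
      · simp [f, hi, (hσ0 0).mpr rfl]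
      · have hn : (‖w i‖ : ℂ) ≠ 0 := by simpa using hw0 i hi
        simp only [f, hi, hσ0, if_false, hw, RCLike.norm_conj]
        rw [div_mul_div_comm, Complex.mul_conj, Complex.normSq_eq_norm_sq]
        push_cast
        field_simp
    · intro i _ hf hfix
      apply hf
      by_cases hi : i = 0
      · simp [f, hi]
      · have hn : (‖w i‖ : ℂ) ≠ 0 := by simpa using hw0 i hi
        have him : (w i).im = 0 := Complex.conj_eq_iff_im.mp (by rw [← hw, hfix])
        have hre : 0 ≤ (w i).re := by simpa [w] using character_re_le γ (c i)
        have heq : w i = ‖w i‖ := by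
          rw [← Complex.re_eq_norm.mpr (Complex.nonneg_iff.mpr ⟨hre, him.symm⟩)]
          exact Complex.ext rfl (by simpa using him)
        simp only [f, hi, if_false]
        rw [← heq, div_self (hw0 i hi)]
  rw [Fin.prod_univ_succ] at hprod
  simp only [f, if_true, one_mul, Fin.succ_ne_zero, if_false, Finset.prod_div_distrib] at hprod
  refine (div_eq_one_iff_eq ?_).mp hprod
  exact Finset.prod_ne_zero_iff.mpr fun i _ => by simpa using hw0 _ i.succ_ne_zero

theorem prod_ne_zero (γ : Representation ℂ G V) (hγ : Function.Injective γ) (ℓ : ℕ)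
    (c : Fin (ℓ + 1) → G) (hc₀ : c 0 = 1)
    (hc : Function.Bijective fun i => ConjClasses.mk (c i)) :
    ∏ i : Fin ℓ, ((finrank ℂ V : ℂ) - γ.character (c i.succ)) ≠ 0 := by
  refine Finset.prod_ne_zero_iff.mpr fun i _ h => i.succ_ne_zero (hc.1 ?_)
  have := eq_one_of_character_eq_finrank γ hγ (c i.succ) (sub_eq_zero.mp h).symm
  exact congrArg ConjClasses.mk (this.trans hc₀.symm)

/-- If `χ_γ` takes the value `a` on `k + 1` classes, then the `k` differences of the corresponding
columns of the character table vanish at the trivial character, so they restrict to eigenvectors of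
the reduced matrix `C`. -/
theorem le_finrank_ker_mcKayCartan_sub (γ : Representation ℂ G V) (a : ℤ) (k : ℕ)
    (g : Fin (k + 1) → G) (hg : Function.Injective fun i => ConjClasses.mk (g i))
    (ha : ∀ i, γ.character (g i) = a) :
    k ≤ finrank ℂ (LinearMap.ker ((mcKayCartan γ - ((finrank ℂ V : ℤ) - a) • 1).map
      (Int.cast : ℤ → ℂ)).mulVecLin) := by
  classical
  let u : Fin k → {χ : Irr G // χ ≠ trivialChar G} → ℂ :=
    fun i χ => χ.1.1 (g i.succ) - χ.1.1 (g 0)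
  have htriv : ∀ x : G, (trivialChar G).1 x = 1 := fun _ => rfl
  have hu : ∀ i, u i ∈ LinearMap.ker ((mcKayCartan γ - ((finrank ℂ V : ℤ) - a) • 1).map
      (Int.cast : ℤ → ℂ)).mulVecLin := by
    intro i
    rw [LinearMap.mem_ker]
    funext χ
    have h1 := extMcKayCartan_mulVec γ (g i.succ) χ.1
    have h2 := extMcKayCartan_mulVec γ (g 0) χ.1
    rw [ha] at h1 h2
    have h3 : ∑ ψ : Irr G, (extMcKayCartan γ χ.1 ψ : ℂ) * (ψ.1 (g i.succ) - ψ.1 (g 0)) =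
        (finrank ℂ V - a) * u i χ := by
      simp only [mul_sub, Finset.sum_sub_distrib, h1, h2, u]
    rw [← Fintype.sum_subtype_add_sum_subtype (fun ψ : Irr G => ψ ≠ trivialChar G)] at h3
    have h4 : ∑ ψ : {ψ : Irr G // ¬ ψ ≠ trivialChar G}, (extMcKayCartan γ χ.1 ψ.1 : ℂ) *
        (ψ.1.1 (g i.succ) - ψ.1.1 (g 0)) = 0 :=
      Finset.sum_eq_zero fun ψ _ => by rw [not_not.mp ψ.2, htriv, htriv, sub_self, mul_zero]
    rw [h4, add_zero] at h3
    have hentry : ∀ ψ, ((mcKayCartan γ - ((finrank ℂ V : ℤ) - a) • 1).map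
        (Int.cast : ℤ → ℂ)) χ ψ = (extMcKayCartan γ χ.1 ψ.1 : ℂ) -
          if χ = ψ then (finrank ℂ V - a : ℂ) else 0 := by
      intro ψ
      rw [Matrix.map_apply, Matrix.sub_apply, Matrix.smul_apply, Matrix.one_apply, mcKayCartan,
        Matrix.submatrix_apply]
      split_ifs <;> simp
    simp only [Matrix.mulVecLin_apply, Matrix.mulVec, dotProduct, hentry, sub_mul,
      Finset.sum_sub_distrib, ite_mul, zero_mul, Finset.sum_ite_eq, Finset.mem_univ, if_true,
      Pi.zero_apply]
    rw [← sub_mul, ← h3]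
    exact sub_self _
  have hli : LinearIndependent ℂ u := by
    rw [Fintype.linearIndependent_iff]
    intro b hb i
    -- `∑ b i (X_{i+1} - X_0)` as a combination of all `k + 1` columns
    have hcol := Fintype.linearIndependent_iff.mp (linearIndependent_columns g hg)
      (Fin.cons (-∑ i, b i) b) ?_ i.succ
    · simpa using hcol
    · funext χ
      have : ∑ i, b i * (χ.1 (g i.succ) - χ.1 (g 0)) = 0 := by
        by_cases hχ : χ = trivialChar G
        · simp [hχ, htriv]
        · simpa [u] using congrFun hb ⟨χ, hχ⟩
      simp only [mul_sub, Finset.sum_sub_distrib, ← Finset.sum_mul] at this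
      simp only [Fin.sum_univ_succ, Fin.cons_zero, Fin.cons_succ, Finset.sum_apply,
        Pi.smul_apply, smul_eq_mul, Pi.zero_apply]
      rw [← this]
      ring
  have hli' : LinearIndependent ℂ fun i => (⟨u i, hu i⟩ : LinearMap.ker _) :=
    LinearIndependent.of_comp (LinearMap.ker _).subtype hli
  simpa using hli'.fintype_card_le_finrank

theorem finrank_ker_transpose {ι : Type*} [Fintype ι] (A : Matrix ι ι ℂ) :
    finrank ℂ (LinearMap.ker A.transpose.mulVecLin) = finrank ℂ (LinearMap.ker A.mulVecLin) := by
  have h1 := LinearMap.finrank_range_add_finrank_ker A.mulVecLin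
  have h2 := LinearMap.finrank_range_add_finrank_ker A.transpose.mulVecLin
  have h3 : finrank ℂ (LinearMap.range A.transpose.mulVecLin) =
      finrank ℂ (LinearMap.range A.mulVecLin) := A.rank_transpose
  omega

end Spectrum

end CriticalGroup

theorem theorem1 {G : Type*} [Group G] [Finite G]
    {V : Type*} [AddCommGroup V] [Module ℂ V] [FiniteDimensional ℂ V]
    (γ : Representation ℂ G V) (hγ : Function.Injective γ)
    (n : ℕ) (hn : Module.finrank ℂ V = n)
    -- `1 = c 0, c 1, …, c ℓ` is a set of conjugacy class representatives
    (ℓ : ℕ) (c : Fin (ℓ + 1) → G) (hc₀ : c 0 = 1)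
    (hc : Function.Bijective fun i => ConjClasses.mk (c i)) :
    (Finite (CriticalGroup.K γ) ∧
      1 / (Nat.card G : ℂ) * ∏ i : Fin ℓ, ((n : ℂ) - γ.character (c i.succ)) =
        (Nat.card (CriticalGroup.K γ) : ℂ)) ∧
    ((∀ g : G, ∃ r : ℝ, γ.character g = (r : ℂ)) →
      ∀ (g : G) (a : ℤ), γ.character g = (a : ℂ) →
        ∀ m : ℕ, m = Nat.card {C : ConjClasses G // ∃ x : G, ConjClasses.mk x = C ∧
            γ.character x = (a : ℂ)} →
          ∃ H : AddSubgroup (CriticalGroup.K γ),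
            Nonempty (H ≃+ (Fin (m - 1) → ZMod ((n : ℤ) - a).natAbs))) := by
  subst hn
  have hG : (Nat.card G : ℂ) ≠ 0 := Nat.cast_ne_zero.mpr Nat.card_pos.ne'
  have hform := CriticalGroup.det_mcKayCartan γ ℓ c hc₀ hc
  have hdet : (CriticalGroup.mcKayCartan γ).det ≠ 0 := by
    intro h
    rw [h, Int.cast_zero] at hform
    exact mul_ne_zero (inv_ne_zero hG) (CriticalGroup.prod_ne_zero γ hγ ℓ c hc₀ hc) hform.symm
  have hdet' : (CriticalGroup.mcKayCartan γ).transpose.det ≠ 0 := by rwa [Matrix.det_transpose]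
  have hcard := CriticalGroup.natCard_coker_eq_natAbs_det _ hdet'
  rw [Matrix.det_transpose] at hcard
  refine ⟨⟨Nat.finite_of_card_ne_zero ?_, ?_⟩, fun _ g a hg m hm => ?_⟩
  · rw [hcard]
    exact Int.natAbs_ne_zero.mpr hdet
  · have hpos : 0 ≤ (CriticalGroup.mcKayCartan γ).det := by
      rw [CriticalGroup.prod_eq_prod_norm γ hγ ℓ c hc₀ hc] at hform
      have h : ((CriticalGroup.mcKayCartan γ).det : ℝ) = (Nat.card G : ℝ)⁻¹ *
          ∏ i : Fin ℓ, ‖(Module.finrank ℂ V : ℂ) - γ.character (c i.succ)‖ := by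
        apply Complex.ofReal_injective
        push_cast [-Int.cast_det]
        exact hform
      have h' : (0 : ℝ) ≤ (CriticalGroup.mcKayCartan γ).det := by
        rw [h]; positivity
      exact_mod_cast h'
    rw [one_div, ← hform, hcard, Nat.cast_natAbs, abs_of_nonneg hpos]
  · refine CriticalGroup.exists_subgroup_coker_of_eigenlattice _ hdet' _ _ ?_
    classical
    let S := {C : ConjClasses G // ∃ x : G, ConjClasses.mk x = C ∧ γ.character x = (a : ℂ)}
    have hS : Nonempty S := ⟨⟨ConjClasses.mk g, g, rfl, hg⟩⟩
    have hm' : Nat.card S = (m - 1) + 1 := by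
      have : 0 < Nat.card S := Nat.card_pos
      have : m = Nat.card S := hm
      omega
    let e : S ≃ Fin ((m - 1) + 1) := Finite.equivFinOfCardEq hm'
    let x : Fin ((m - 1) + 1) → G := fun i => (e.symm i).2.choose
    have hx : ∀ i, ConjClasses.mk (x i) = (e.symm i).1 := fun i => (e.symm i).2.choose_spec.1
    have hle := CriticalGroup.le_finrank_ker_mcKayCartan_sub γ a (m - 1) x
      (fun i j hij => e.symm.injective (Subtype.ext (by rw [← hx, ← hx]; exact hij)))
      (fun i => (e.symm i).2.choose_spec.2)
    rw [← CriticalGroup.finrank_ker_transpose, ← Matrix.transpose_map, Matrix.transpose_sub,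
      Matrix.transpose_smul, Matrix.transpose_one] at hle
    exact hle.trans (CriticalGroup.finrank_ker_map_le _)
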